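/- Conventions. An algebra of the signature of $\mathsf{QEA}_\omega$ has the Boolean operations, the cylindrifications ${\sf c}_i$, the diagonal constants ${\sf d}_{ij}$, the replacement operations ${\sf s}_{[i/j]}$ and the transposition operations ${\sf s}_{[i,j]}$ $(i,j<\omega)$. Its cylindric reduct $\mathfrak{Rd}_{ca}$ omits all ${\sf s}_{[i/j]}$ and ${\sf s}_{[i,j]}$, and its diagonal-free reduct $\mathfrak{Rd}_{qa}$ omits all ${\sf d}_{ij}$. If $V$ is a set of $\omega$-sequences, then on $\wp(V)$ these operations are ${\sf c}_iX=\{s\in V:(\exists t\in X)(\forall j\ne i)\,t_j=s_j\}$, ${\sf d}_{ij}=\{s\in V:s_i=s_j\}$, ${\sf s}_{[i/j]}X=\{s\in V:s\circ[i/j]\in X\}$ and ${\sf s}_{[i,j]}X=\{s\in V:s\circ[i,j]\in X\}$. An algebra of the signature of $\mathsf{QEA}_\omega$ (of its cylindric reducts, of its diagonal-free reducts) is representable, that is, belongs to $\mathsf{RQEA}_\omega$ ($\mathsf{RCA}_\omega$, $\mathsf{RQA}_\omega$), if it is isomorphic to a subalgebra of $\wp(V)$, in that signature, for some union $V=\bigcup_{j\in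 J}{}^{\omega}W_j$ with pairwise disjoint non-empty sets $W_j$. A universal formula in at most $k$ variables is a formula $\forall x_1\cdots\forall x_n\,\psi$ with $n\le k$ and $\psi$ quantifier-free with variables among $x_1,\dots,x_n$. A set $\Sigma$ of formulas axiomatizes $\mathsf{RQEA}_\omega$ over $\mathsf{RQA}_\omega$ if, for every algebra $\mathfrak A$ of the signature of $\mathsf{QEA}_\omega$, $\mathfrak A\in\mathsf{RQEA}_\omega$ if and only if $\mathfrak A\models\Sigma$ and $\mathfrak{Rd}_{qa}\mathfrak A\in\mathsf{RQA}_\omega$. For $n<\omega$ let $L_n$ be the signature of $\mathsf{CA}_\omega$ together with ${\sf s}_{[i/j]},{\sf s}_{[i,j]}$ for $i,j<n$. An $L_n$-algebra $\mathfrak C$ is obtained from its subalgebra $\mathfrak A$ by splitting an atom $R$ of $\mathfrak A$ if there are a finite number $m\ge 2$ and distinct atoms $R_0,\dots,R_{m-1}$ of $\mathfrak C$ with $\sum_{l<m}R_l=R$ and ${\sf c}_tR_l={\sf c}_tR$ for all $l<m$, $t<\omega$, such that $\mathfrak C$ is generated by $A\cup\{R_0,\dots,R_{m-1}\}$. By a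 set algebra we mean here a subalgebra of some $\wp({}^{\omega}U)$, $U\neq\emptyset$, up to isomorphism. Theorem. (1) There are no $k<\omega$ and no set $\Sigma$ of universal formulas, each in at most $k$ variables, such that $\Sigma$ axiomatizes $\mathsf{RQEA}_\omega$ over $\mathsf{RQA}_\omega$. (2) For every $k<\omega$ there is an algebra $\mathfrak B_k$ of the signature of $\mathsf{QEA}_\omega$ such that (a) $\mathfrak B_k$ is the union of a chain $\mathfrak C_0\subseteq\mathfrak C_1\subseteq\cdots$ in which each $\mathfrak C_n$ is a subalgebra of the $L_n$-reduct of $\mathfrak B_k$ and is obtained from a set algebra by splitting an atom; (b) $\mathfrak{Rd}_{ca}\mathfrak B_k\notin\mathsf{RCA}_\omega$; (c) every subalgebra of $\mathfrak B_k$ generated by at most $k$ elements is in $\mathsf{RQEA}_\omega$; (d) $\mathfrak{Rd}_{qa}\mathfrak B_k\in\mathsf{RQA}_\omega$. -/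

import Mathlib

open FirstOrder FirstOrder.Language

universe u

/-- The operation symbols (indexed by their arity) of the cylindric-like algebras of
dimension `ω`: Boolean operations, cylindrifications `c_i`, diagonal constants `d_ij` (present iff
`D`), and, for those `i, j` with `P i j`, the replacement operations `s_{[i/j]}` and the
transposition operations `s_{[i,j]}`. -/
inductive CylSym (D : Prop) (P : ℕ → ℕ → Prop) : ℕ → Type
  | bot : CylSym D P 0
  | top : CylSym D P 0
  | compl : CylSym D P 1
  | sup : CylSym D P 2
  | inf : CylSym D P 2
  | cyl (i : ℕ) : CylSym D P 1
  | diag (hD : D) (i j : ℕ) : CylSym D P 0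
  | repl (i j : ℕ) (hP : P i j) : CylSym D P 1
  | transp (i j : ℕ) (hP : P i j) : CylSym D P 1

/-- The signature with operation symbols `CylSym D P` and no relation symbols but equality. -/
def cylLang (D : Prop) (P : ℕ → ℕ → Prop) : FirstOrder.Language.{0, 0} where
  Functions := CylSym D P
  Relations := fun _ => Empty

/-- The signature of `QEA_ω`. -/
abbrev LQEA : FirstOrder.Language.{0, 0} := cylLang True (fun _ _ => True)

/-- The signature of `QA_ω`: no diagonal constants. -/
abbrev LQA : FirstOrder.Language.{0, 0} := cylLang False (fun _ _ => True)

/-- The signature of `CA_ω`: no substitution operations. -/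
abbrev LCA : FirstOrder.Language.{0, 0} := cylLang True (fun _ _ => False)

/-- The signature of `CA_ω` with the substitution operations whose indices are below `n`. -/
abbrev LFin (n : ℕ) : FirstOrder.Language.{0, 0} := cylLang True (fun i j => i < n ∧ j < n)

/-- The symbols of each of the signatures are symbols of `QEA_ω`. -/
def CylSym.toQEA {D : Prop} {P : ℕ → ℕ → Prop} :
    ∀ {n : ℕ}, CylSym D P n → CylSym True (fun _ _ => True) n
  | _, .bot => .bot
  | _, .top => .top
  | _, .compl => .compl
  | _, .sup => .sup
  | _, .inf => .inf
  | _, .cyl i => .cyl i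
  | _, .diag _ i j => .diag trivial i j
  | _, .repl i j _ => .repl i j trivial
  | _, .transp i j _ => .transp i j trivial

/-- The universe of the reduct of an algebra `A` in the signature of `QEA_ω` to the signature
`cylLang D P`. -/
def Reduct (_D : Prop) (_P : ℕ → ℕ → Prop) (A : Type u) : Type u := A

/-- The reduct of an algebra, in which the remaining operations are those of `A`. -/
instance Reduct.instStructure (D : Prop) (P : ℕ → ℕ → Prop) (A : Type u) [LQEA.Structure A] :
    (cylLang D P).Structure (Reduct D P A) where
  funMap := fun {_} f x =>
    Structure.funMap (L := LQEA) (M := A) (CylSym.toQEA f : CylSym True (fun _ _ => True) _) x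
  RelMap := fun {_} r _ => nomatch (r : Empty)

/-- The cylindric reduct. -/
abbrev RdCA (A : Type u) : Type u := Reduct True (fun _ _ => False) A

/-- The diagonal-free (quasi-polyadic) reduct. -/
abbrev RdQA (A : Type u) : Type u := Reduct False (fun _ _ => True) A

/-- The reduct with only the substitution operations whose indices are below `n`. -/
abbrev RdFin (n : ℕ) (A : Type u) : Type u := Reduct True (fun i j => i < n ∧ j < n) A

/-- The replacement `[i/j]`, which sends `i` to `j` and fixes everything else. -/
def replMap (i j : ℕ) : ℕ → ℕ := Function.update id i j

/-- The operations on the subsets of a set `V` of `ω`-sequences, relativized to `V`: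
`c_i X = {s ∈ V : s and some t ∈ X agree off i}`, `d_ij = {s ∈ V : s_i = s_j}`,
`s_{[i/j]} X = {s ∈ V : s ∘ [i/j] ∈ X}`, `s_{[i,j]} X = {s ∈ V : s ∘ [i,j] ∈ X}`. -/
def setAlgFun {D : Prop} {P : ℕ → ℕ → Prop} {U : Type u} (V : Set (ℕ → U)) :
    ∀ {n : ℕ}, CylSym D P n → (Fin n → Set V) → Set V
  | _, .bot, _ => ∅
  | _, .top, _ => Set.univ
  | _, .compl, x => (x 0)ᶜ
  | _, .sup, x => x 0 ∪ x 1
  | _, .inf, x => x 0 ∩ x 1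
  | _, .cyl i, x => {s | ∃ t ∈ x 0, ∀ j, j ≠ i → t.1 j = s.1 j}
  | _, .diag _ i j, _ => {s | s.1 i = s.1 j}
  | _, .repl i j _, x => {s | ∃ t ∈ x 0, t.1 = s.1 ∘ replMap i j}
  | _, .transp i j _, x => {s | ∃ t ∈ x 0, t.1 = s.1 ∘ Equiv.swap i j}

/-- The algebra of all subsets of `V`. -/
instance setAlg (D : Prop) (P : ℕ → ℕ → Prop) {U : Type u} (V : Set (ℕ → U)) :
    (cylLang D P).Structure (Set V) where
  funMap := fun {_} f x => setAlgFun (D := D) (P := P) V f x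
  RelMap := fun {_} r _ => nomatch (r : Empty)

/-- `V` is the unit of a generalized set algebra: a union of Cartesian spaces `^ω(W j)` with
pairwise disjoint non-empty bases `W j`. -/
def IsGeneralizedSpace {U : Type u} (V : Set (ℕ → U)) : Prop :=
  ∃ (J : Type u) (W : J → Set U), (∀ j, (W j).Nonempty) ∧
    (∀ j j', j ≠ j' → Disjoint (W j) (W j')) ∧ V = {s | ∃ j, ∀ i, s i ∈ W j}

/-- Representability: being isomorphic to a generalized set algebra, that is, to a subalgebra of
the algebra of all subsets of a generalized space. -/
def IsRepresentable (D : Prop) (P : ℕ → ℕ → Prop) (A : Type u) [(cylLang D P).Structure A] : Prop :=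
  ∃ (U : Type u) (V : Set (ℕ → U)), IsGeneralizedSpace V ∧ Nonempty (A ↪[cylLang D P] Set V)

/-- Being isomorphic to a set algebra with unit `^ωU`, for a single non-empty base `U`. -/
def IsSetAlgebra (D : Prop) (P : ℕ → ℕ → Prop) (A : Type u) [(cylLang D P).Structure A] : Prop :=
  ∃ U : Type u, Nonempty U ∧ Nonempty (A ↪[cylLang D P] Set (Set.univ : Set (ℕ → U)))

/-- `A ∈ RQEA_ω`. -/
def IsRQEA (A : Type u) [LQEA.Structure A] : Prop := IsRepresentable True (fun _ _ => True) A

/-- `A ∈ RQA_ω`. -/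
def IsRQA (A : Type u) [LQA.Structure A] : Prop := IsRepresentable False (fun _ _ => True) A

/-- `A ∈ RCA_ω`. -/
def IsRCA (A : Type u) [LCA.Structure A] : Prop := IsRepresentable True (fun _ _ => False) A

/-- A universal formula (its free variables being understood as universally quantified) in at
most `k` variables: the universal closure `∀ x₁ … ∀ xₙ ψ`, with `n ≤ k`, of a quantifier-free
formula `ψ` whose variables are among `x₁, …, xₙ`. -/
def IsUniversalIn (k : ℕ) (φ : LQEA.Sentence) : Prop :=
  ∃ n ≤ k, ∃ ψ : LQEA.BoundedFormula Empty n, ψ.IsQF ∧ φ = ψ.alls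

section Splitting

variable {B : Type u} [LQEA.Structure B]

/-- The zero element. -/
def zeroOf (B : Type u) [LQEA.Structure B] : B :=
  Structure.funMap (L := LQEA) (M := B) (CylSym.bot : CylSym True (fun _ _ => True) 0) ![]

/-- The Boolean order `x · y = x`. -/
def BLe (x y : B) : Prop :=
  Structure.funMap (L := LQEA) (M := B) (CylSym.inf : CylSym True (fun _ _ => True) 2) ![x, y] = x

/-- The cylindrification `c_t`. -/
def cylOf (t : ℕ) (x : B) : B :=
  Structure.funMap (L := LQEA) (M := B) (CylSym.cyl t : CylSym True (fun _ _ => True) 1) ![x]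

/-- `a` is an atom of the subalgebra with universe `S`. -/
def IsAtomIn (S : Set B) (a : B) : Prop :=
  a ∈ S ∧ a ≠ zeroOf B ∧ ∀ x ∈ S, BLe x a → x = zeroOf B ∨ x = a

/-- The algebra `C` (in the signature `LFin n`) is obtained from a set algebra `A` by splitting an
atom `R` of `A` into finitely many, but at least two, parts `r i`: these are distinct atoms of `C`
with sum `R`, each of them is cylindrically equivalent to `R`, and together with `A` they
generate `C`. -/
def IsAtomSplitting (n : ℕ) (A C : (LFin n).Substructure (RdFin n B)) : Prop :=
  IsSetAlgebra True (fun i j => i < n ∧ j < n) A ∧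
  ∃ (R : B) (m : ℕ) (r : Fin m → B),
    IsAtomIn (B := B) (A : Set (RdFin n B)) R ∧
    2 ≤ m ∧ Function.Injective r ∧
    (∀ i, IsAtomIn (B := B) (C : Set (RdFin n B)) (r i)) ∧
    (∀ x : B, BLe R x ↔ ∀ i, BLe (r i) x) ∧
    (∀ i t, cylOf t (r i) = cylOf t R) ∧
    C = Substructure.closure (LFin n) ((A : Set (RdFin n B)) ∪ (Set.range r : Set B))

/-- `B` is the union of a chain `C 0 ⊆ C 1 ⊆ …`, where `C n` is a subalgebra of the reduct of `B`
with the substitution operations of indices below `n`, and `C n` is obtained from a set algebra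
by splitting an atom. -/
def IsUnionOfSplittings (B : Type u) [LQEA.Structure B] : Prop :=
  ∃ A C : ∀ n, (LFin n).Substructure (RdFin n B),
    (∀ n, IsAtomSplitting n (A n) (C n)) ∧
    (∀ n n', n ≤ n' → ∀ x : B, x ∈ C n → x ∈ C n') ∧
    (∀ x : B, ∃ n, x ∈ C n)

end Splitting

/-! The base has blocks `{b} × V`, for `b : ℕ`, together with all functions from points to a finite
set `Z`. The base permutations respecting transversality and function application act transitively
on the transversal sequences (`exists_isSym_comp_eq`), so in the algebra of invariant sets of
sequences these form one atom. It is split by attaching labels from `P` that are visible at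
transversal sequences only. The substitutions cope with this: a proper replacement destroys
transversality, and a transposition keeps the label.

If `|P| > |Z| ≥ 3|V|`, even the cylindric reduct is not representable (`not_isRCA`). In a
representation, varying the first term of a labelled sequence gives `|P|` different values, one per
label. They are all free, that is, possible first terms once the places from 3 on are fixed. In the
base the free points lie in three blocks, so some function to `Z` is injective on them. The algebra
expresses this injectivity, and the representation inherits it, contrary to the pigeonhole
principle.

On the other hand, `k` generators distinguish at most `2 ^ k` kinds of label. If `|V| ≥ 2 ^ k`, the
transversals can be coloured by `V`, independently of order and so that each colour is reached by
changing any one term inside its block (`exists_coloring`); this represents the generated subalgebra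
on the same base (`isRQEA_closure`). Without diagonals, points may be duplicated until there is room
for all labels (`isRQA`). Both use `SplitAlg.nonempty_embedding`. Part (1) follows since a universal
formula in `k` variables is tested on `k`-generated subalgebras. -/

/-! ### Transversal sequences and their colourings. -/

/-- A sequence is transversal if it meets each block exactly once. -/
def IsTransversal {Y : Type*} (bl : Y → Option ℕ) (s : ℕ → Y) : Prop :=
  ∃ σ : Equiv.Perm ℕ, ∀ i, bl (s i) = some (σ i)

theorem IsTransversal.comp_perm {Y : Type*} {bl : Y → Option ℕ} {s : ℕ → Y}
    (h : IsTransversal bl s) (τ : Equiv.Perm ℕ) : IsTransversal bl (s ∘ τ) := by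
  obtain ⟨σ, hσ⟩ := h
  exact ⟨τ.trans σ, fun i => hσ (τ i)⟩

theorem isTransversal_comp_perm_iff {Y : Type*} {bl : Y → Option ℕ} {s : ℕ → Y}
    (τ : Equiv.Perm ℕ) : IsTransversal bl (s ∘ τ) ↔ IsTransversal bl s := by
  refine ⟨fun h => ?_, fun h => h.comp_perm τ⟩
  have := h.comp_perm τ.symm
  rwa [Function.comp_assoc, Equiv.self_comp_symm, Function.comp_id] at this

theorem not_isTransversal_comp_replMap {Y : Type*} {bl : Y → Option ℕ} {s : ℕ → Y} {i j : ℕ}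
    (hij : i ≠ j) : ¬ IsTransversal bl (s ∘ replMap i j) := by
  rintro ⟨σ, hσ⟩
  have h1 := hσ i
  have h2 := hσ j
  simp only [Function.comp, replMap, Function.update_self, Function.update_of_ne hij.symm,
    id] at h1 h2
  exact hij (σ.injective (Option.some_injective _ (h1.symm.trans h2)))

theorem IsTransversal.of_blk_eq {Y : Type*} {bl : Y → Option ℕ} {s t : ℕ → Y}
    (h : IsTransversal bl s) (hst : ∀ i, bl (t i) = bl (s i)) : IsTransversal bl t := by
  obtain ⟨σ, hσ⟩ := h
  exact ⟨σ, fun i => (hst i).trans (hσ i)⟩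

/-- A sum of the terms of a sequence, defined relative to chosen representatives of the classes of
sequences which differ at finitely many places only. -/
theorem exists_relative_sum (W : Type*) [AddCommGroup W] :
    ∃ χ : (ℕ → W) → W, ∀ w i a, χ (Function.update w i a) = χ w - w i + a := by
  classical
  -- The sum is taken over the finitely supported difference from the chosen representative modulo
  -- `H`. An update stays in the same coset, so it changes one summand only.
  let H : AddSubgroup (ℕ → W) := (Finsupp.coeFnAddHom : (ℕ →₀ W) →+ (ℕ → W)).range
  have key : ∀ w : ℕ → W, ∃ d : ℕ →₀ W, (d : ℕ → W) = w - (w : (ℕ → W) ⧸ H).out := by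
    intro w
    have : -(w : (ℕ → W) ⧸ H).out + w ∈ H := by
      rw [← QuotientAddGroup.eq]
      exact Quotient.out_eq _
    obtain ⟨d, hd⟩ := this
    exact ⟨d, hd.trans (by abel)⟩
  choose d hd using key
  refine ⟨fun w => (d w).sum fun _ x => x, fun w i a => ?_⟩
  have hup : Function.update w i a = w + (Finsupp.single i (a - w i) : ℕ →₀ W) := by
    ext j
    rcases eq_or_ne j i with rfl | hj
    · simp
    · simp [hj]
  have hq : ((Function.update w i a : ℕ → W) : (ℕ → W) ⧸ H) = (w : (ℕ → W) ⧸ H) := by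
    rw [eq_comm, QuotientAddGroup.eq, hup]
    exact ⟨Finsupp.single i (a - w i), (neg_add_cancel_left _ _).symm⟩
  have hdd : d (Function.update w i a) = d w + Finsupp.single i (a - w i) := by
    apply DFunLike.coe_injective
    rw [Finsupp.coe_add, hd, hd, hq, hup]
    abel
  simp only [hdd]
  rw [Finsupp.sum_add_index' (fun _ => rfl) (fun _ _ _ => rfl), Finsupp.sum_single_index rfl]
  abel

/-- There is a colouring of the transversal sequences which does not depend on the order of the
terms, such that each colour can be reached by a change of any one term in its block. -/
theorem exists_coloring {Y W : Type*} [AddCommGroup W] (bl : Y → Option ℕ) (val : Y → W)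
    (hval : ∀ y b, bl y = some b → ∀ w, ∃ y', bl y' = some b ∧ val y' = w) :
    ∃ χ : (ℕ → Y) → W,
      (∀ s (τ : Equiv.Perm ℕ), IsTransversal bl s → χ (s ∘ τ) = χ s) ∧
      ∀ s i w, IsTransversal bl s → ∃ y, bl y = bl (s i) ∧ χ (Function.update s i y) = w := by
  classical
  obtain ⟨χ₀, hχ₀⟩ := exists_relative_sum W
  -- Indexing the values by blocks instead of places makes the order of the terms irrelevant. The
  -- default 0 never occurs for transversal sequences.
  let v : (ℕ → Y) → ℕ → W := fun s b =>
    if h : ∃ i, bl (s i) = some b then val (s h.choose) else 0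
  have hv : ∀ s (σ : Equiv.Perm ℕ), (∀ i, bl (s i) = some (σ i)) →
      v s = fun b => val (s (σ.symm b)) := by
    intro s σ hσ
    funext b
    have h : ∃ i, bl (s i) = some b := ⟨σ.symm b, by rw [hσ, Equiv.apply_symm_apply]⟩
    have h2 : h.choose = σ.symm b := by
      have := h.choose_spec
      rw [hσ] at this
      rw [Equiv.eq_symm_apply]
      exact Option.some_injective _ this
    simp only [v]
    rw [dif_pos h, h2]
  refine ⟨fun s => χ₀ (v s), ?_, ?_⟩
  · rintro s τ ⟨σ, hσ⟩
    have : v (s ∘ τ) = v s := by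
      rw [hv s σ hσ, hv (s ∘ τ) (τ.trans σ) (fun i => hσ (τ i))]
      funext b
      simp
    simp only [this]
  · rintro s i w ⟨σ, hσ⟩
    -- The new value solves `χ₀ (v s) - val (s i) + val y = w`.
    obtain ⟨y, hy, hyw⟩ := hval (s i) (σ i) (hσ i) (w - χ₀ (v s) + val (s i))
    refine ⟨y, hy.trans (hσ i).symm, ?_⟩
    have hσ' : ∀ j, bl (Function.update s i y j) = some (σ j) := by
      intro j
      rcases eq_or_ne j i with rfl | hj
      · rw [Function.update_self, hy]
      · rw [Function.update_of_ne hj, hσ]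
    have : v (Function.update s i y) = Function.update (v s) (σ i) (val y) := by
      rw [hv _ σ hσ', hv s σ hσ]
      funext b
      rcases eq_or_ne b (σ i) with rfl | hb
      · simp
      · rw [Function.update_of_ne hb, Function.update_of_ne]
        rwa [Ne, Equiv.symm_apply_eq]
    simp only [this, hχ₀, hv s σ hσ, hyw, Equiv.symm_apply_apply]
    abel

/-! ### The split algebra and a criterion for representing it. -/

section SplitAlgebra

/-- The base of the set algebra: the points of the blocks `{b} × V`, and the functions from the
set of points to `Z`. -/
abbrev Base (V : Type u) (Z : Type) : Type u := (ℕ × V) ⊕ ((ℕ × V) → Z)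

/-- The block of a point. -/
def blk {V : Type u} {Z : Type} : Base V Z → Option ℕ := Sum.elim (fun x => some x.1) fun _ => none

/-- The value of a function at a point. -/
def app {V : Type u} {Z : Type} : Base V Z → Base V Z → Option Z
  | .inr c, .inl x => some (c x)
  | _, _ => none

/-- The permutations of the base which preserve the transversals and the application of
functions to points. -/
def IsSym {V : Type u} {Z : Type} (g : Equiv.Perm (Base V Z)) : Prop :=
  (∀ s, IsTransversal blk (g ∘ s) ↔ IsTransversal blk s) ∧ ∀ x y, app (g x) (g y) = app x y

/-- Permute the blocks as the two orders require, translate inside each block by the group `V`, and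
transport the functions along this permutation of the points. -/
theorem exists_isSym_comp_eq {V : Type u} {Z : Type} [AddCommGroup V] {s t : ℕ → Base V Z}
    (hs : IsTransversal blk s) (ht : IsTransversal blk t) : ∃ g, IsSym g ∧ g ∘ s = t := by
  have hform : ∀ {s : ℕ → Base V Z}, IsTransversal blk s →
      ∃ (σ : Equiv.Perm ℕ) (v : ℕ → V), ∀ i, s i = .inl (σ i, v i) := by
    rintro s ⟨σ, hσ⟩
    have : ∀ i, ∃ v : V, s i = .inl (σ i, v) := by
      intro i
      have := hσ i
      rcases hsi : s i with ⟨b, v⟩ | c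
      · rw [hsi] at this
        simp only [blk, Sum.elim_inl, Option.some.injEq] at this
        exact ⟨v, by rw [this]⟩
      · rw [hsi] at this
        simp [blk] at this
    choose v hv using this
    exact ⟨σ, v, hv⟩
  obtain ⟨σ, v, hs⟩ := hform hs
  obtain ⟨τ, w, ht⟩ := hform ht
  let ρ : Equiv.Perm ℕ := σ.symm.trans τ
  let e : Equiv.Perm (ℕ × V) :=
    { toFun := fun x => (ρ x.1, x.2 - v (σ.symm x.1) + w (σ.symm x.1))
      invFun := fun x => (ρ.symm x.1, x.2 - w (τ.symm x.1) + v (τ.symm x.1))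
      left_inv := fun x => by simp [ρ]
      right_inv := fun x => by simp [ρ] }
  let g : Equiv.Perm (Base V Z) := Equiv.sumCongr e (Equiv.arrowCongr e (Equiv.refl Z))
  have hblk : ∀ x, blk (g x) = (blk x).map ρ := by
    rintro (x | c) <;> rfl
  refine ⟨g, ⟨fun s => ⟨?_, ?_⟩, ?_⟩, ?_⟩
  · rintro ⟨π, hπ⟩
    refine ⟨π.trans ρ.symm, fun i => ?_⟩
    have := hπ i
    simp only [Function.comp, hblk, Option.map_eq_some_iff] at this
    obtain ⟨a, ha, hb⟩ := this
    simp [ha, ← hb]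
  · rintro ⟨π, hπ⟩
    refine ⟨π.trans ρ, fun i => ?_⟩
    simp [hblk, hπ]
  · rintro (x | c) (y | d) <;> simp [app, g]
  · funext i
    simp only [Function.comp, hs, ht]
    simp [g, e, ρ]

theorem IsSym.symm {V : Type u} {Z : Type} {g : Equiv.Perm (Base V Z)} (hg : IsSym g) :
    IsSym g.symm := by
  refine ⟨fun s => ?_, fun x y => ?_⟩
  · rw [← hg.1, ← Function.comp_assoc, Equiv.self_comp_symm, Function.id_comp]
  · rw [← hg.2, Equiv.apply_symm_apply, Equiv.apply_symm_apply]

/-- The operations on the sets of pairs of a sequence and a label. -/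
def pairOp {U P : Type*} : ∀ {n : ℕ}, CylSym True (fun _ _ => True) n →
    (Fin n → Set ((ℕ → U) × P)) → Set ((ℕ → U) × P)
  | _, .bot, _ => ∅
  | _, .top, _ => Set.univ
  | _, .compl, x => (x 0)ᶜ
  | _, .sup, x => x 0 ∪ x 1
  | _, .inf, x => x 0 ∩ x 1
  | _, .cyl i, x => {p | ∃ q ∈ x 0, ∀ j, j ≠ i → q.1 j = p.1 j}
  | _, .diag _ i j, _ => {p | p.1 i = p.1 j}
  | _, .repl i j _, x => {p | (p.1 ∘ replMap i j, p.2) ∈ x 0}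
  | _, .transp i j _, x => {p | (p.1 ∘ Equiv.swap i j, p.2) ∈ x 0}

/-- Sets of pairs in which the sequences can be moved by symmetries of the base, and in which
the labels matter at the transversal sequences only. -/
def IsAdmissible {V : Type u} {Z P : Type} (Y : Set ((ℕ → Base V Z) × P)) : Prop :=
  (∀ g, IsSym g → ∀ s l, (s, l) ∈ Y → (g ∘ s, l) ∈ Y) ∧
    ∀ s l l', ¬ IsTransversal blk s → (s, l) ∈ Y → (s, l') ∈ Y

variable {V : Type u} {Z P : Type}

theorem IsAdmissible.sym_iff {Y : Set ((ℕ → Base V Z) × P)} (hY : IsAdmissible Y)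
    {g : Equiv.Perm (Base V Z)} (hg : IsSym g) (s : ℕ → Base V Z) (l : P) :
    (g ∘ s, l) ∈ Y ↔ (s, l) ∈ Y := by
  refine ⟨fun h => ?_, hY.1 g hg s l⟩
  have := hY.1 _ hg.symm _ _ h
  rwa [← Function.comp_assoc, Equiv.symm_comp_self, Function.id_comp] at this

theorem IsAdmissible.label_iff {Y : Set ((ℕ → Base V Z) × P)} (hY : IsAdmissible Y)
    {s : ℕ → Base V Z} (hs : ¬ IsTransversal blk s) (l l' : P) : (s, l) ∈ Y ↔ (s, l') ∈ Y :=
  ⟨hY.2 s l l' hs, hY.2 s l' l hs⟩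

theorem IsAdmissible.transversal_iff [AddCommGroup V] {Y : Set ((ℕ → Base V Z) × P)}
    (hY : IsAdmissible Y) {s t : ℕ → Base V Z} (hs : IsTransversal blk s)
    (ht : IsTransversal blk t) (l : P) : (s, l) ∈ Y ↔ (t, l) ∈ Y := by
  obtain ⟨g, hg, rfl⟩ := exists_isSym_comp_eq hs ht
  exact (hY.sym_iff hg s l).symm

/-- Cylindrification forgets the label, a proper replacement leads out of the transversals, where
labels are ignored, and a transposition respects non-transversality. -/
theorem IsAdmissible.pairOp {n : ℕ} (f : CylSym True (fun _ _ => True) n)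
    {x : Fin n → Set ((ℕ → Base V Z) × P)} (hx : ∀ i, IsAdmissible (x i)) :
    IsAdmissible (pairOp f x) := by
  cases f with
  | bot => exact ⟨fun _ _ _ _ h => h, fun _ _ _ _ h => h⟩
  | top => exact ⟨fun _ _ _ _ h => h, fun _ _ _ _ h => h⟩
  | compl =>
    exact ⟨fun g hg s l h => mt ((hx 0).sym_iff hg s l).1 h,
      fun s l l' hs h => mt ((hx 0).label_iff hs l l').2 h⟩
  | sup =>
    exact ⟨fun g hg s l h => h.imp ((hx 0).1 g hg s l) ((hx 1).1 g hg s l),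
      fun s l l' hs h => h.imp ((hx 0).2 s l l' hs) ((hx 1).2 s l l' hs)⟩
  | inf =>
    exact ⟨fun g hg s l h => h.imp ((hx 0).1 g hg s l) ((hx 1).1 g hg s l),
      fun s l l' hs h => h.imp ((hx 0).2 s l l' hs) ((hx 1).2 s l l' hs)⟩
  | cyl i =>
    refine ⟨?_, fun s l l' hs h => h⟩
    rintro g hg s l ⟨⟨t, l'⟩, ht, hts⟩
    exact ⟨(g ∘ t, l'), (hx 0).1 g hg t l' ht, fun j hj => congrArg g (hts j hj)⟩
  | diag _ i j => exact ⟨fun g hg s l h => congrArg g h, fun s l l' hs h => h⟩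
  | repl i j =>
    refine ⟨fun g hg s l h => (hx 0).1 g hg _ l h, fun s l l' hs h => ?_⟩
    rcases eq_or_ne i j with rfl | hij
    · have hid : replMap i i = id := Function.update_eq_self i id
      simp only [_root_.pairOp, hid, Function.comp_id] at h ⊢
      exact (hx 0).2 s l l' hs h
    · exact (hx 0).2 _ l l' (not_isTransversal_comp_replMap hij) h
  | transp i j =>
    refine ⟨fun g hg s l h => (hx 0).1 g hg _ l h, fun s l l' hs h => ?_⟩
    exact (hx 0).2 _ l l' (mt (isTransversal_comp_perm_iff _).1 hs) h

/-- The algebra obtained from the algebra of the invariant sets of sequences by splitting the atom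
of the transversal sequences into parts labelled by `P`. -/
@[ext]
structure SplitAlg (V : Type u) (Z P : Type) : Type u where
  /-- The underlying set of pairs. -/
  val : Set ((ℕ → Base V Z) × P)
  isAdmissible : IsAdmissible val

instance SplitAlg.instStructure : LQEA.Structure (SplitAlg V Z P) where
  funMap := fun {_} f x => ⟨pairOp (f : CylSym True (fun _ _ => True) _) fun i => (x i).1,
    IsAdmissible.pairOp _ fun i => (x i).2⟩
  RelMap := fun {_} r _ => nomatch (r : Empty)

/-- The representation of (a subalgebra of a reduct of) the split algebra given by a map of the
base and a colouring of the sequences. -/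
theorem SplitAlg.nonempty_embedding [AddCommGroup V] {D : Prop} {Q : ℕ → ℕ → Prop} {N : Type u}
    [(cylLang D Q).Structure N] (j : N → SplitAlg V Z P) (hj : Function.Injective j)
    (hmap : ∀ {n : ℕ} (f : CylSym D Q n) (x : Fin n → N),
      (j (Structure.funMap (L := cylLang D Q) (M := N) f x)).1 =
        pairOp f.toQEA fun i => (j (x i)).1)
    {U : Type u} (f : U → Base V Z) (hf : Function.Surjective f) (hD : D → Function.Injective f)
    (χ : (ℕ → U) → P)
    (hsymm : ∀ s (τ : Equiv.Perm ℕ), IsTransversal blk (f ∘ s) → χ (s ∘ τ) = χ s)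
    (hχ : ∀ s i l, IsTransversal blk (f ∘ s) → ∃ u, blk (f u) = blk (f (s i)) ∧
      ∀ (y : N) t, (t, χ (Function.update s i u)) ∈ (j y).1 ↔ (t, l) ∈ (j y).1) :
    Nonempty (N ↪[cylLang D Q] Set (Set.univ : Set (ℕ → U))) := by
  -- Each pair reachable by a change in place `i` is matched by a genuine sequence, up to what `N`
  -- can distinguish. This gives the cylindrifications and, started from any lift of `t`,
  -- injectivity.
  have hlift : ∀ (s : ℕ → U) (i : ℕ) (t : ℕ → Base V Z) (l : P),
      (∀ k, k ≠ i → t k = f (s k)) → ∃ u, ∀ y : N,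
        (f ∘ Function.update s i u, χ (Function.update s i u)) ∈ (j y).1 ↔ (t, l) ∈ (j y).1 := by
    intro s i t l hts
    obtain ⟨u, hu⟩ := hf (t i)
    have hup : f ∘ Function.update s i u = t := by
      funext k
      rcases eq_or_ne k i with rfl | hk
      · simp [hu]
      · simp [hk, hts k hk]
    by_cases ht : IsTransversal blk t
    · obtain ⟨u', hu', h⟩ := hχ (Function.update s i u) i l (by rwa [hup])
      rw [Function.update_idem] at h
      refine ⟨u', fun y => (((j y).2.transversal_iff ?_ ht _)).trans (h y t)⟩
      refine ht.of_blk_eq fun k => ?_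
      rw [← hup]
      rcases eq_or_ne k i with rfl | hk
      · simpa using hu'
      · simp [hk]
    · exact ⟨u, fun y => by rw [hup]; exact (j y).2.label_iff ht _ _⟩
  let h : N → Set (Set.univ : Set (ℕ → U)) := fun y => {s | (f ∘ s.1, χ s.1) ∈ (j y).1}
  refine ⟨⟨⟨h, ?_⟩, ?_, fun r => nomatch (r : Empty)⟩⟩
  · intro y y' hyy
    apply hj
    apply SplitAlg.ext
    ext ⟨t, l⟩
    choose s hs using fun k => hf (t k)
    obtain ⟨u, hu⟩ := hlift s 0 t l fun k _ => (hs k).symm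
    rw [← hu y, ← hu y']
    exact Set.ext_iff.1 hyy ⟨Function.update s 0 u, trivial⟩
  · intro n (F : CylSym D Q n) x
    change h (Structure.funMap (L := cylLang D Q) (M := N) F x) =
      setAlgFun (D := D) (P := Q) _ F (h ∘ x)
    ext ⟨s, hs⟩
    change (f ∘ s, χ s) ∈ (j (Structure.funMap (L := cylLang D Q) (M := N) F x)).1 ↔ _
    refine (Set.ext_iff.1 (hmap F x) _).trans ?_
    cases F with
    | bot => exact Iff.rfl
    | top => exact Iff.rfl
    | compl => exact Iff.rfl
    | sup => exact Iff.rfl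
    | inf => exact Iff.rfl
    | cyl i =>
      constructor
      · rintro ⟨⟨t, l⟩, ht, hts⟩
        obtain ⟨u, hu⟩ := hlift s i t l hts
        exact ⟨⟨Function.update s i u, trivial⟩, (hu (x 0)).2 ht,
          fun k hk => Function.update_of_ne hk _ _⟩
      · rintro ⟨⟨t, _⟩, ht, hts⟩
        exact ⟨_, ht, fun k hk => congrArg f (hts k hk)⟩
    | diag hd i k => exact (hD hd).eq_iff
    | repl i k hP =>
      have : (f ∘ s ∘ replMap i k, χ s) ∈ (j (x 0)).1 ↔
          (f ∘ s ∘ replMap i k, χ (s ∘ replMap i k)) ∈ (j (x 0)).1 := by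
        rcases eq_or_ne i k with rfl | hik
        · have hid : replMap i i = id := Function.update_eq_self i id
          rw [hid, Function.comp_id]
        · rw [← Function.comp_assoc]
          exact (j (x 0)).2.label_iff (not_isTransversal_comp_replMap hik) _ _
      refine this.trans ⟨fun h => ⟨⟨s ∘ replMap i k, trivial⟩, h, rfl⟩, ?_⟩
      rintro ⟨⟨t, _⟩, ht, rfl⟩
      exact ht
    | transp i k hP =>
      have : (f ∘ s ∘ Equiv.swap i k, χ s) ∈ (j (x 0)).1 ↔
          (f ∘ s ∘ Equiv.swap i k, χ (s ∘ Equiv.swap i k)) ∈ (j (x 0)).1 := by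
        by_cases ht : IsTransversal blk (f ∘ s)
        · rw [hsymm s _ ht]
        · rw [← Function.comp_assoc]
          exact (j (x 0)).2.label_iff (mt (isTransversal_comp_perm_iff _).1 ht) _ _
      refine this.trans ⟨fun h => ⟨⟨s ∘ Equiv.swap i k, trivial⟩, h, rfl⟩, ?_⟩
      rintro ⟨⟨t, _⟩, ht, rfl⟩
      exact ht

end SplitAlgebra

/-! ### The algebra as a splitting of a set algebra. -/

namespace SplitAlg

variable {V : Type u} {Z P : Type}

/-- The element given by an invariant set of sequences. -/
def embed (X : Set (ℕ → Base V Z)) (hX : ∀ g, IsSym g → ∀ s ∈ X, g ∘ s ∈ X) : SplitAlg V Z P where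
  val := {p | p.1 ∈ X}
  isAdmissible := ⟨fun g hg s _ => hX g hg s, fun _ _ _ _ h => h⟩

/-- The element of the transversal sequences. -/
def transversals (V : Type u) (Z P : Type) : SplitAlg V Z P :=
  embed {s | IsTransversal blk s} fun _ hg s => (hg.1 s).2

/-- The part of the transversal sequences with a given label. -/
def part (V : Type u) (Z : Type) {P : Type} (l : P) : SplitAlg V Z P where
  val := {p | IsTransversal blk p.1 ∧ p.2 = l}
  isAdmissible := ⟨fun _ hg s _ h => ⟨(hg.1 s).2 h.1, h.2⟩, fun _ _ _ hs h => absurd h.1 hs⟩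

theorem exists_isTransversal (V : Type u) (Z : Type) [AddCommGroup V] :
    ∃ s : ℕ → Base V Z, IsTransversal blk s :=
  ⟨fun i => .inl (i, 0), Equiv.refl ℕ, fun _ => rfl⟩

theorem bLe_iff {x y : SplitAlg V Z P} : BLe x y ↔ x.val ⊆ y.val := by
  rw [← Set.inter_eq_left]
  exact ⟨fun h => congrArg val h, fun h => SplitAlg.ext h⟩

theorem eq_zeroOf_iff {x : SplitAlg V Z P} : x = zeroOf _ ↔ x.val = ∅ :=
  ⟨fun h => congrArg val h, fun h => SplitAlg.ext h⟩

theorem pairOp_label_iff {U P : Type*} {l l' : P} {n : ℕ} (f : CylSym True (fun _ _ => True) n)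
    {x : Fin n → Set ((ℕ → U) × P)} (hx : ∀ i s, (s, l) ∈ x i ↔ (s, l') ∈ x i) (s : ℕ → U) :
    (s, l) ∈ pairOp f x ↔ (s, l') ∈ pairOp f x := by
  cases f with
  | bot => exact Iff.rfl
  | top => exact Iff.rfl
  | compl => exact not_congr (hx 0 s)
  | sup => exact or_congr (hx 0 s) (hx 1 s)
  | inf => exact and_congr (hx 0 s) (hx 1 s)
  | cyl i => exact Iff.rfl
  | diag _ i j => exact Iff.rfl
  | repl i j => exact hx 0 _
  | transp i j => exact hx 0 _

/-- The subalgebra of the unsplit elements. -/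
def unsplit (V : Type u) (Z P : Type) (n : ℕ) :
    (LFin n).Substructure (RdFin n (SplitAlg V Z P)) where
  carrier := {Y : SplitAlg V Z P | ∀ l l' s, (s, l) ∈ Y.val ↔ (s, l') ∈ Y.val}
  fun_mem := fun {_} _ _ hx l l' s => pairOp_label_iff _ (fun i => hx i l l') s

/-- Unsplit elements ignore labels, so a constant colouring represents them. -/
theorem isSetAlgebra_unsplit [AddCommGroup V] [Nonempty P] (n : ℕ) :
    IsSetAlgebra True (fun i j => i < n ∧ j < n) (unsplit V Z P n) := by
  refine ⟨Base V Z, ⟨.inl (0, 0)⟩, ?_⟩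
  let j : unsplit V Z P n → SplitAlg V Z P := fun Y => Y.1
  exact nonempty_embedding j (fun _ _ h => Subtype.ext h) (fun _ _ => rfl) id
    Function.surjective_id (fun _ => Function.injective_id) (fun _ => Classical.arbitrary P)
    (fun _ _ _ => rfl) fun s i l _ => ⟨s i, rfl, fun y t => y.2 _ _ t⟩

theorem cylOf_part (l : P) (t : ℕ) :
    cylOf t (part V Z l) = cylOf t (transversals V Z P) := by
  apply SplitAlg.ext
  ext ⟨s, l'⟩
  constructor
  · rintro ⟨q, hq, h⟩
    exact ⟨q, hq.1, h⟩
  · rintro ⟨q, hq, h⟩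
    exact ⟨(q.1, l), ⟨hq, rfl⟩, h⟩

theorem part_injective [AddCommGroup V] :
    Function.Injective (part V Z : P → SplitAlg V Z P) := by
  intro l l' h
  obtain ⟨s, hs⟩ := exists_isTransversal V Z
  have : (s, l) ∈ (part V Z l').val := h ▸ (⟨hs, rfl⟩ : (s, l) ∈ (part V Z l).val)
  exact this.2

theorem isAtomIn_transversals [AddCommGroup V] [Nonempty P] (n : ℕ) :
    IsAtomIn (B := SplitAlg V Z P) (unsplit V Z P n : Set (RdFin n (SplitAlg V Z P)))
      (transversals V Z P) := by
  obtain ⟨s, hs⟩ := exists_isTransversal V Z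
  refine ⟨fun _ _ _ => Iff.rfl, fun h => ?_, fun x hx hle => ?_⟩
  · exact Set.eq_empty_iff_forall_notMem.1 (eq_zeroOf_iff.1 h) (s, Classical.arbitrary P) hs
  · rw [bLe_iff] at hle
    rw [eq_zeroOf_iff, or_iff_not_imp_left, ← Ne, ← Set.nonempty_iff_ne_empty]
    rintro ⟨⟨t, l⟩, ht⟩
    refine SplitAlg.ext (hle.antisymm ?_)
    rintro ⟨t', l'⟩ ht'
    exact (hx l l' t').1 ((x.2.transversal_iff (hle ht) ht' l).1 ht)

theorem isAtomIn_part [AddCommGroup V] (S : Set (SplitAlg V Z P)) {l : P}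
    (hl : part V Z l ∈ S) : IsAtomIn S (part V Z l) := by
  obtain ⟨s, hs⟩ := exists_isTransversal V Z
  refine ⟨hl, fun h => ?_, fun x hx hle => ?_⟩
  · exact Set.eq_empty_iff_forall_notMem.1 (eq_zeroOf_iff.1 h) (s, l) ⟨hs, rfl⟩
  · rw [bLe_iff] at hle
    rw [eq_zeroOf_iff, or_iff_not_imp_left, ← Ne, ← Set.nonempty_iff_ne_empty]
    rintro ⟨⟨t, l₀⟩, ht⟩
    obtain ⟨ht1, rfl⟩ := hle ht
    refine SplitAlg.ext (hle.antisymm ?_)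
    rintro ⟨t', _⟩ ⟨ht', rfl⟩
    exact (x.2.transversal_iff ht1 ht' _).1 ht

/-- An element is its unsplit non-transversal part joined with finitely many labelled parts. Since
no substitutions are needed for this, the chain can be constant. -/
theorem closure_unsplit_union_range_part [AddCommGroup V] [Finite P] (n : ℕ) :
    Substructure.closure (LFin n)
      ((unsplit V Z P n : Set (RdFin n (SplitAlg V Z P))) ∪
        (Set.range (part V Z) : Set (SplitAlg V Z P))) = ⊤ := by
  classical
  cases nonempty_fintype P
  rw [eq_top_iff]
  rintro (Y : SplitAlg V Z P) -
  set C := Substructure.closure (LFin n)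
      ((unsplit V Z P n : Set (RdFin n (SplitAlg V Z P))) ∪
        (Set.range (part V Z) : Set (SplitAlg V Z P))) with hC
  let off : SplitAlg V Z P :=
    { val := {p | ¬ IsTransversal blk p.1 ∧ p ∈ Y.val}
      isAdmissible := ⟨fun g hg s l h => ⟨mt (hg.1 s).1 h.1, Y.2.1 g hg s l h.2⟩,
        fun s l l' hs h => ⟨hs, Y.2.2 s l l' hs h.2⟩⟩ }
  let parts : Finset P → SplitAlg V Z P := fun S =>
    { val := {p | IsTransversal blk p.1 ∧ p.2 ∈ S}
      isAdmissible := ⟨fun _ hg s _ h => ⟨(hg.1 s).2 h.1, h.2⟩,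
        fun _ _ _ hs h => absurd h.1 hs⟩ }
  have hsup : ∀ X X' X'' : SplitAlg V Z P, X ∈ C → X' ∈ C → X''.val = X.val ∪ X'.val →
      X'' ∈ C := by
    intro X X' X'' hX hX' h
    have := C.fun_mem (CylSym.sup : CylSym True (fun i j => i < n ∧ j < n) 2) ![X, X']
      (by intro i; fin_cases i <;> assumption)
    have heq : X'' = Structure.funMap (L := LQEA) (M := SplitAlg V Z P)
        (CylSym.sup : CylSym True (fun _ _ => True) 2) ![X, X'] := SplitAlg.ext h
    rw [heq]
    exact this
  have hoff : off ∈ C := by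
    refine Substructure.subset_closure (Or.inl fun l l' s => ?_)
    exact and_congr_right fun hs => Y.2.label_iff hs l l'
  have hparts : ∀ S, parts S ∈ C := by
    intro S
    induction S using Finset.induction_on with
    | empty =>
      refine Substructure.subset_closure (Or.inl fun l l' s => ?_)
      simp [parts]
    | insert l S hl ih =>
      refine hsup (part V Z l) (parts S) _ (Substructure.subset_closure (Or.inr ⟨l, rfl⟩)) ih ?_
      ext ⟨s, l'⟩
      simp [parts, part, and_or_left]
  obtain ⟨s₀, hs₀⟩ := exists_isTransversal V Z
  refine hsup off (parts {l | (s₀, l) ∈ Y.val}) Y hoff (hparts _) ?_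
  ext ⟨s, l⟩
  by_cases hs : IsTransversal blk s
  · simp [off, parts, hs, Y.2.transversal_iff hs hs₀ l]
  · simp [off, parts, hs]

theorem isUnionOfSplittings [AddCommGroup V] {m : ℕ} (hm : 2 ≤ m) :
    IsUnionOfSplittings (SplitAlg V Z (Fin m)) := by
  have : Nonempty (Fin m) := ⟨⟨0, by omega⟩⟩
  refine ⟨fun n => unsplit V Z (Fin m) n, fun _ => ⊤, fun n => ⟨isSetAlgebra_unsplit n, ?_⟩,
    fun _ _ _ _ _ => trivial, fun _ => ⟨0, trivial⟩⟩
  refine ⟨transversals V Z (Fin m), m, part V Z, isAtomIn_transversals n, hm, part_injective,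
    fun i => isAtomIn_part _ trivial, fun x => ?_, cylOf_part,
    (closure_unsplit_union_range_part n).symm⟩
  simp only [bLe_iff]
  exact ⟨fun h i p hp => h hp.1, fun h p hp => h p.2 ⟨hp, rfl⟩⟩

end SplitAlg

/-! ### Non-representability of the cylindric reduct. -/

namespace SplitAlg

variable {V : Type u} {Z P : Type}

/-- A shared value forces both sequences into the same Cartesian component, where terms may be mixed
freely. -/
theorem _root_.IsGeneralizedSpace.mem_of_range {U : Type u} {S : Set (ℕ → U)}
    (hS : IsGeneralizedSpace S) {p q r : ℕ → U} (hp : p ∈ S) (hq : q ∈ S) (k : ℕ) (hk : p k = q k)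
    (hr : ∀ i, (∃ j, r i = p j) ∨ ∃ j, r i = q j) : r ∈ S := by
  obtain ⟨J, W, -, hdisj, rfl⟩ := hS
  obtain ⟨a, ha⟩ := hp
  obtain ⟨b, hb⟩ := hq
  have hab : a = b := by
    by_contra hne
    exact Set.disjoint_left.1 (hdisj a b hne) (ha k) (hk ▸ hb k)
  subst hab
  refine ⟨a, fun i => ?_⟩
  rcases hr i with ⟨j, h⟩ | ⟨j, h⟩ <;> rw [h]
  exacts [ha j, hb j]

section Embedding

variable {U : Type u} {S : Set (ℕ → U)} (h : RdCA (SplitAlg V Z P) ↪[LCA] Set S)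

/-- The value of an embedding of the cylindric reduct at an element of the split algebra. -/
def image (Y : SplitAlg V Z P) : Set S := h Y

theorem image_op {n : ℕ} (f : CylSym True (fun _ _ => False) n) (x : Fin n → SplitAlg V Z P)
    (Y : SplitAlg V Z P) (hY : Y.val = pairOp f.toQEA fun i => (x i).val) :
    image h Y = setAlgFun (D := True) (P := fun _ _ => False) S f fun i => image h (x i) := by
  have : Y = ⟨pairOp f.toQEA fun i => (x i).val, hY ▸ Y.2⟩ := SplitAlg.ext hY
  rw [this]
  exact h.map_fun' f x

theorem image_inter {Y Y' X : SplitAlg V Z P} (hX : X.val = Y.val ∩ Y'.val) :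
    image h X = image h Y ∩ image h Y' :=
  image_op h .inf ![Y, Y'] X hX

theorem image_union {Y Y' X : SplitAlg V Z P} (hX : X.val = Y.val ∪ Y'.val) :
    image h X = image h Y ∪ image h Y' :=
  image_op h .sup ![Y, Y'] X hX

theorem image_empty {X : SplitAlg V Z P} (hX : X.val = ∅) : image h X = ∅ :=
  image_op h .bot ![] X hX

theorem image_mono {X Y : SplitAlg V Z P} (hXY : X.val ⊆ Y.val) : image h X ⊆ image h Y := by
  rw [image_inter h (Set.inter_eq_left.2 hXY).symm]
  exact Set.inter_subset_right

theorem image_inter_subset {X Y Y' : SplitAlg V Z P} (hX : Y.val ∩ Y'.val ⊆ X.val) :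
    image h Y ∩ image h Y' ⊆ image h X := by
  let I : SplitAlg V Z P := ⟨Y.val ∩ Y'.val,
    IsAdmissible.pairOp .inf (x := ![Y.val, Y'.val]) (by intro i; fin_cases i; exacts [Y.2, Y'.2])⟩
  rw [← image_inter h (X := I) rfl]
  exact image_mono h hX

/-- Cylindrification in the split algebra. -/
def cyl (i : ℕ) (Y : SplitAlg V Z P) : SplitAlg V Z P :=
  ⟨{p | ∃ q ∈ Y.val, ∀ j, j ≠ i → q.1 j = p.1 j},
    IsAdmissible.pairOp (.cyl i) (x := fun _ => Y.val) fun _ => Y.2⟩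

theorem image_cyl (i : ℕ) (Y : SplitAlg V Z P) :
    image h (cyl i Y) = {s | ∃ t ∈ image h Y, ∀ j, j ≠ i → t.1 j = s.1 j} :=
  image_op h (.cyl i) (fun _ => Y) _ rfl

theorem exists_of_subset_cyl {X Y : SplitAlg V Z P} {i : ℕ} (hXY : X.val ⊆ (cyl i Y).val)
    {p : S} (hp : p ∈ image h X) : ∃ q ∈ image h Y, ∀ j, j ≠ i → q.1 j = p.1 j := by
  have := image_mono h hXY hp
  rwa [image_cyl] at this

theorem mem_of_cyl_subset {X Y : SplitAlg V Z P} {i : ℕ} (hXY : (cyl i Y).val ⊆ X.val)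
    {p q : S} (hq : q ∈ image h Y) (hpq : ∀ j, j ≠ i → q.1 j = p.1 j) : p ∈ image h X := by
  apply image_mono h hXY
  rw [image_cyl]
  exact ⟨q, hq, hpq⟩

/-- The diagonal elements of the split algebra. -/
def diag (V : Type u) (Z P : Type) (i j : ℕ) : SplitAlg V Z P :=
  embed {s | s i = s j} fun g _ _ hs => congrArg g hs

theorem image_diag (i j : ℕ) : image h (diag V Z P i j) = {s | s.1 i = s.1 j} :=
  image_op h (.diag trivial i j) ![] _ rfl

end Embedding

/-- The points which occur in some place before the third one of a transversal sequence with the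
same tail as `s`. -/
def Free (s : ℕ → Base V Z) (x : Base V Z) : Prop :=
  ∃ t, IsTransversal blk t ∧ t 0 = x ∧ ∀ j, 3 ≤ j → t j = s j

theorem Free.congr {s s' : ℕ → Base V Z} {x : Base V Z} (hx : Free s x)
    (hs : ∀ j, 3 ≤ j → s j = s' j) : Free s' x := by
  obtain ⟨t, ht, h0, htail⟩ := hx
  exact ⟨t, ht, h0, fun j hj => (htail j hj).trans (hs j hj)⟩

theorem Free.sym {g : Equiv.Perm (Base V Z)} (hg : IsSym g) {s : ℕ → Base V Z} {x : Base V Z}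
    (hx : Free s x) : Free (g ∘ s) (g x) := by
  obtain ⟨t, ht, rfl, htail⟩ := hx
  exact ⟨g ∘ t, (hg.1 t).2 ht, rfl, fun j hj => congrArg g (htail j hj)⟩

theorem Free.sym_symm {g : Equiv.Perm (Base V Z)} (hg : IsSym g) {s : ℕ → Base V Z} {x : Base V Z}
    (hx : Free (g ∘ s) x) : Free s (g.symm x) := by
  have := hx.sym hg.symm
  rwa [← Function.comp_assoc, Equiv.symm_comp_self, Function.id_comp] at this

/-- The third term is a function which is injective on the free points. -/
def Codes (s : ℕ → Base V Z) : Prop :=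
  (∀ x, Free s x → ∃ z, app (s 2) x = some z) ∧
    ∀ x y, Free s x → Free s y → app (s 2) x = app (s 2) y → x = y

theorem Codes.congr {s s' : ℕ → Base V Z} (hc : Codes s) (hs : ∀ j, 2 ≤ j → s j = s' j) :
    Codes s' := by
  have hf : ∀ x, Free s' x → Free s x := fun x hx =>
    hx.congr fun j hj => (hs j (by omega)).symm
  refine ⟨fun x hx => ?_, fun x y hx hy hxy => ?_⟩
  · rw [← hs 2 le_rfl]
    exact hc.1 x (hf x hx)
  · rw [← hs 2 le_rfl] at hxy
    exact hc.2 x y (hf x hx) (hf y hy) hxy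

theorem Codes.sym {g : Equiv.Perm (Base V Z)} (hg : IsSym g) {s : ℕ → Base V Z} (hc : Codes s) :
    Codes (g ∘ s) := by
  have happ : ∀ x, app ((g ∘ s) 2) x = app (s 2) (g.symm x) := by
    intro x
    rw [← hg.2 (s 2), Equiv.apply_symm_apply]
    rfl
  refine ⟨fun x hx => ?_, fun x y hx hy hxy => ?_⟩
  · rw [happ]
    exact hc.1 _ (hx.sym_symm hg)
  · rw [happ, happ] at hxy
    exact g.symm.injective (hc.2 _ _ (hx.sym_symm hg) (hy.sym_symm hg) hxy)

/-- Free points lie in the three blocks which `s` meets before place 3, so `Fin 3 × V` suffices to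
tell them apart. -/
theorem exists_codes (e : Fin 3 × V → Z) (he : Function.Injective e) {s : ℕ → Base V Z}
    (hs : IsTransversal blk s) : ∃ c, Codes (Function.update s 2 c) := by
  obtain ⟨σ, hσ⟩ := hs
  -- The value 2 at all further blocks is harmless, since they contain no free points.
  let num : ℕ → Fin 3 := fun b => if b = σ 0 then 0 else if b = σ 1 then 1 else 2
  have hfree : ∀ c x, Free (Function.update s 2 c) x →
      ∃ b v, x = .inl (b, v) ∧ (b = σ 0 ∨ b = σ 1 ∨ b = σ 2) := by
    rintro c x ⟨t, ⟨τ, hτ⟩, rfl, htail⟩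
    have ht0 := hτ 0
    rcases htx : t 0 with ⟨b, v⟩ | d
    · rw [htx] at ht0
      have hb : b = τ 0 := Option.some_injective _ ht0
      refine ⟨b, v, rfl, ?_⟩
      -- Otherwise `t` would meet the block `b` both at place 0 and in the tail shared with `s`.
      have hj : σ.symm b < 3 := by
        by_contra hge
        push Not at hge
        have h1 := htail _ hge
        rw [Function.update_of_ne (by omega)] at h1
        have h2 := hτ (σ.symm b)
        rw [h1, hσ, Equiv.apply_symm_apply] at h2
        have h3 := τ.injective (hb.symm.trans (Option.some_injective _ h2))
        omega
      have hb' : b = σ (σ.symm b) := (Equiv.apply_symm_apply _ _).symm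
      generalize σ.symm b = j at hj hb'
      subst hb'
      interval_cases j <;> simp
    · rw [htx] at ht0
      simp [blk] at ht0
  have hnum : ∀ b b', (b = σ 0 ∨ b = σ 1 ∨ b = σ 2) → (b' = σ 0 ∨ b' = σ 1 ∨ b' = σ 2) →
      num b = num b' → b = b' := by
    have h1 : σ 1 ≠ σ 0 := σ.injective.ne (by decide)
    have h2 : σ 2 ≠ σ 0 := σ.injective.ne (by decide)
    have h3 : σ 2 ≠ σ 1 := σ.injective.ne (by decide)
    rintro b b' (rfl | rfl | rfl) (rfl | rfl | rfl) <;> simp [num, h1, h2, h3]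
  refine ⟨.inr fun x => e (num x.1, x.2), fun x hx => ?_, fun x y hx hy hxy => ?_⟩
  · obtain ⟨b, v, rfl, -⟩ := hfree _ x hx
    exact ⟨_, rfl⟩
  · obtain ⟨b, v, rfl, hb⟩ := hfree _ x hx
    obtain ⟨b', v', rfl, hb'⟩ := hfree _ y hy
    rw [Function.update_self] at hxy
    have := he (Option.some_injective _ hxy)
    rw [Prod.mk.injEq] at this
    exact congrArg Sum.inl (Prod.ext (hnum b b' hb hb' this.1) this.2)

/-- The sequences whose first term is a free point with a code in `J`. -/
def codedIn (V : Type u) {Z : Type} (P : Type) (J : Set Z) : SplitAlg V Z P :=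
  embed {s | Codes s ∧ Free s (s 0) ∧ ∃ z ∈ J, app (s 2) (s 0) = some z} fun g hg s hs =>
    ⟨hs.1.sym hg, hs.2.1.sym hg, by simpa only [Function.comp, hg.2] using hs.2.2⟩

/-- An embedding preserves finite unions only; this is where the finiteness of the set of codes
enters. -/
theorem exists_mem_image_codedIn_singleton {U : Type u} {S : Set (ℕ → U)}
    (h : RdCA (SplitAlg V Z P) ↪[LCA] Set S) (J : Finset Z) {p : S}
    (hp : p ∈ image h (codedIn V P (J : Set Z))) : ∃ z, p ∈ image h (codedIn V P {z}) := by
  classical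
  induction J using Finset.induction_on with
  | empty =>
    rw [image_empty h (by ext; simp [codedIn, embed])] at hp
    exact hp.elim
  | insert z J _ ih =>
    rw [image_union h (Y := codedIn V P {z}) (Y' := codedIn V P (J : Set Z))] at hp
    · exact hp.elim (fun hp => ⟨z, hp⟩) ih
    · ext ⟨s, l⟩
      simp only [codedIn, embed, Set.mem_ofPred_eq, Set.mem_union, ← and_or_left]
      simp

theorem not_isRCA [AddCommGroup V] [Fintype Z] [Fintype P] (e : Fin 3 × V → Z)
    (he : Function.Injective e) (hcard : Fintype.card Z < Fintype.card P) :
    ¬ IsRCA (RdCA (SplitAlg V Z P)) := by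
  rintro ⟨U, S, hS, ⟨h⟩⟩
  have l₀ : P := (Fintype.card_pos_iff.1 (by omega : 0 < Fintype.card P)).some
  let T := transversals V Z P
  let N : SplitAlg V Z P := embed {s | Codes s} fun _ hg _ hs => hs.sym hg
  let F : SplitAlg V Z P := embed {s | Free s (s 0)} fun _ hg _ hs => hs.sym hg
  obtain ⟨s, hs⟩ : (image h (part V Z l₀)).Nonempty := by
    rw [Set.nonempty_iff_ne_empty]
    intro h0
    have hb : image h (zeroOf (SplitAlg V Z P)) = ∅ := image_empty h rfl
    have := h.injective (h0.trans hb.symm)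
    exact (isAtomIn_part {part V Z l₀} rfl).2.1 this
  have hpart : ∀ l, image h (part V Z l) ⊆ image h T := fun l => image_mono h fun _ hp => hp.1
  have hTN : T.val ⊆ (cyl 2 N).val := by
    rintro ⟨t, l⟩ ht
    obtain ⟨c, hc⟩ := exists_codes e he ht
    exact ⟨(Function.update t 2 c, l), hc, fun j hj => Function.update_of_ne hj _ _⟩
  obtain ⟨s', hs', hss'⟩ := exists_of_subset_cyl h hTN (hpart l₀ hs)
  have ht : ∀ l, ∃ t ∈ image h (part V Z l), ∀ j, j ≠ 0 → t.1 j = s.1 j := by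
    intro l
    refine exists_of_subset_cyl h ?_ hs
    rintro ⟨t, l'⟩ ht
    exact ⟨(t, l), ⟨ht.1, rfl⟩, fun _ _ => rfl⟩
  choose t ht hts using ht
  have ht0 : ∀ l l', (t l).1 0 = (t l').1 0 → l = l' := by
    intro l l' hll
    have : t l = t l' := by
      apply Subtype.ext
      funext j
      rcases eq_or_ne j 0 with rfl | hj
      · exact hll
      · rw [hts l j hj, hts l' j hj]
    by_contra hne
    have hmem : t l ∈ image h (zeroOf (SplitAlg V Z P)) := by
      refine image_inter_subset h ?_ ⟨ht l, this ▸ ht l'⟩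
      rintro p ⟨hp, hp'⟩
      exact (hne (hp.2.symm.trans hp'.2)).elim
    rw [image_empty h rfl] at hmem
    exact hmem
  -- The first term comes from the sequence labelled `l`, the code in place 2 from `s'`; all else is
  -- common to both.
  let p : P → S := fun l => ⟨Function.update (t l).1 2 (s'.1 2),
    hS.mem_of_range (t l).2 s'.2 1 (by rw [hts l 1 (by decide), hss' 1 (by decide)]) fun i => by
      rcases eq_or_ne i 2 with rfl | hi
      · exact .inr ⟨2, by simp⟩
      · exact .inl ⟨i, by simp [hi]⟩⟩
  have hp0 : ∀ l, (p l).1 0 = (t l).1 0 := fun l => by simp [p]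
  have hps : ∀ l j, j ≠ 0 → (p l).1 j = s'.1 j := by
    intro l j hj
    rcases eq_or_ne j 2 with rfl | hj2
    · simp [p]
    · simp only [p]
      rw [Function.update_of_ne hj2, hts l j hj, hss' j hj2]
  have hpN : ∀ l, p l ∈ image h N := by
    intro l
    refine mem_of_cyl_subset h (i := 0) ?_ hs' fun j hj => (hps l j hj).symm
    rintro ⟨r, _⟩ ⟨q, hq, hqr⟩
    exact Codes.congr hq fun j hj => hqr j (by omega)
  have hpF : ∀ l, p l ∈ image h F := by
    intro l
    refine mem_of_cyl_subset h (i := 2) (Y := T) ?_ (hpart l (ht l))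
      fun j hj => (Function.update_of_ne hj _ _).symm
    rintro ⟨r, _⟩ ⟨q, hq, hqr⟩
    exact ⟨q.1, hq, hqr 0 (by decide), fun j hj => hqr j (by omega)⟩
  have hpz : ∀ l, ∃ z, p l ∈ image h (codedIn V P {z}) := by
    intro l
    refine exists_mem_image_codedIn_singleton h Finset.univ ?_
    refine image_inter_subset h ?_ ⟨hpN l, hpF l⟩
    rintro ⟨r, _⟩ ⟨hr, hr'⟩
    obtain ⟨z, hz⟩ := hr.1 _ hr'
    exact ⟨hr, hr', z, by simp, hz⟩
  choose z hz using hpz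
  obtain ⟨l, l', hne, hzz⟩ := Fintype.exists_ne_map_eq_of_card_lt z hcard
  -- Place 1 is irrelevant for being coded, so it can serve to compare two first terms.
  have hcyl : ∀ J : Set Z, (cyl 1 (codedIn V P J)).val ⊆ (codedIn V P J).val := by
    rintro J r ⟨q, ⟨hq1, hq2, hq3⟩, hqr⟩
    have h0 : q.1 0 = r.1 0 := hqr 0 (by decide)
    have h2 : q.1 2 = r.1 2 := hqr 2 (by decide)
    refine ⟨hq1.congr fun j hj => hqr j (by omega), ?_, ?_⟩
    · rw [← h0]
      exact hq2.congr fun j hj => hqr j (by omega)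
    · rwa [← h0, ← h2]
  have h12 : (p l).1 1 = (p l').1 1 := by rw [hps l 1 (by decide), hps l' 1 (by decide)]
  -- Both `q` and `r` carry the first term of `p l'` in place 1. In place 0, `q` repeats it, while
  -- `r` keeps the first term of `p l`.
  let q : S := ⟨Function.update (p l').1 1 ((p l').1 0),
    hS.mem_of_range (p l').2 (p l').2 0 rfl fun i => by
      rcases eq_or_ne i 1 with rfl | hi
      · exact .inl ⟨0, by simp⟩
      · exact .inl ⟨i, by simp [hi]⟩⟩
  let r : S := ⟨Function.update (p l).1 1 ((p l').1 0),
    hS.mem_of_range (p l).2 (p l').2 1 h12 fun i => by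
      rcases eq_or_ne i 1 with rfl | hi
      · exact .inr ⟨0, by simp⟩
      · exact .inl ⟨i, by simp [hi]⟩⟩
  have hq : q ∈ image h (codedIn V P {z l}) := by
    rw [hzz]
    exact mem_of_cyl_subset h (hcyl _) (hz l') fun j hj => (Function.update_of_ne hj _ _).symm
  have hr : r ∈ image h (codedIn V P {z l}) :=
    mem_of_cyl_subset h (hcyl _) (hz l) fun j hj => (Function.update_of_ne hj _ _).symm
  let A : SplitAlg V Z P :=
    embed {s | s 0 = s 1 ∧ Free s (s 0) ∧ app (s 2) (s 0) = some (z l)} fun g hg s hs =>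
      ⟨congrArg g hs.1, hs.2.1.sym hg, by simpa only [Function.comp, hg.2] using hs.2.2⟩
  let A' : SplitAlg V Z P :=
    embed {s | Free s (s 1) ∧ app (s 2) (s 1) = some (z l)} fun g hg s hs =>
      ⟨hs.1.sym hg, by simpa only [Function.comp, hg.2] using hs.2⟩
  -- The diagonal moves the information about the code from place 0 to place 1; changing place 0
  -- then passes it on to `r`.
  have hqA : q ∈ image h A := by
    refine image_inter_subset h (Y := diag V Z P 0 1) ?_ ⟨?_, hq⟩
    · rintro ⟨x, _⟩ ⟨hx, hx'⟩
      obtain ⟨-, hx1, w, rfl, hx2⟩ := hx'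
      exact ⟨hx, hx1, hx2⟩
    · rw [image_diag]
      simp [q]
  have hrA' : r ∈ image h A' := by
    refine mem_of_cyl_subset h (i := 0) ?_ hqA fun j hj => ?_
    · rintro x ⟨y, ⟨hy1, hy2, hy3⟩, hyx⟩
      have h1 : y.1 0 = x.1 1 := hy1.trans (hyx 1 (by decide))
      have h2 : y.1 2 = x.1 2 := hyx 2 (by decide)
      refine ⟨?_, ?_⟩
      · rw [← h1]
        exact hy2.congr fun j hj => hyx j (by omega)
      · rwa [← h1, ← h2]
    · rcases eq_or_ne j 1 with rfl | hj1
      · simp [q, r]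
      · simp only [q, r]
        rw [Function.update_of_ne hj1, Function.update_of_ne hj1, hps l j hj, hps l' j hj]
  -- The terms of `r` in places 0 and 1 are both free with code `z l`, so injectivity of the code
  -- puts `r` on the diagonal.
  have hrd : r ∈ image h (diag V Z P 0 1) := by
    refine image_inter_subset h ?_ ⟨hr, hrA'⟩
    rintro ⟨x, _⟩ ⟨⟨hx1, hx2, w, rfl, hx3⟩, hx4, hx5⟩
    exact hx1.2 _ _ hx2 hx4 (hx3.trans hx5.symm)
  rw [image_diag] at hrd
  have : (p l).1 0 = (p l').1 0 := by simpa [r] using hrd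
  rw [hp0, hp0] at this
  exact hne (ht0 l l' this)

end SplitAlg

/-! ### Reducts and universal formulas in few variables. -/

theorem isGeneralizedSpace_univ (U : Type u) [Nonempty U] :
    IsGeneralizedSpace (Set.univ : Set (ℕ → U)) :=
  ⟨PUnit, fun _ => Set.univ, fun _ => Set.univ_nonempty,
    fun j j' hne => (hne (Subsingleton.elim j j')).elim,
    Set.ext fun _ => ⟨fun _ => ⟨PUnit.unit, fun _ => trivial⟩, fun _ => trivial⟩⟩

theorem IsRQEA.isRCA {A : Type u} [LQEA.Structure A] (hA : IsRQEA A) : IsRCA (RdCA A) := by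
  obtain ⟨U, S, hS, ⟨h⟩⟩ := hA
  refine ⟨U, S, hS, ⟨⟨⟨h.toFun, h.injective⟩, ?_, fun r => nomatch (r : Empty)⟩⟩⟩
  intro n (f : CylSym True (fun _ _ => False) n) x
  refine (h.map_fun' (CylSym.toQEA f : CylSym True (fun _ _ => True) n) x).trans ?_
  cases f with
  | bot => rfl
  | top => rfl
  | compl => rfl
  | sup => rfl
  | inf => rfl
  | cyl i => rfl
  | diag _ i j => rfl
  | repl i j hP => exact hP.elim
  | transp i j hP => exact hP.elim

/-- Any assignment of the variables has at most `k` values, and quantifier-free truth is the same in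
the subalgebra they generate. -/
theorem IsUniversalIn.realize {k : ℕ} {φ : LQEA.Sentence} (hφ : IsUniversalIn k φ) {B : Type u}
    [LQEA.Structure B]
    (h : ∀ G : Finset B, G.card ≤ k → (Substructure.closure LQEA (G : Set B)) ⊨ φ) : B ⊨ φ := by
  classical
  obtain ⟨n, hn, ψ, hψ, rfl⟩ := hφ
  refine BoundedFormula.realize_alls.2 fun xs => ?_
  let G : Finset B := Finset.univ.image xs
  have hG : G.card ≤ k := (Finset.card_image_le.trans (by simp)).trans hn
  let ys : Fin n → Substructure.closure LQEA (G : Set B) := fun i =>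
    ⟨xs i, Substructure.subset_closure (by simp [G])⟩
  have := (hψ.realize_embedding (Substructure.closure LQEA (G : Set B)).subtype).2
    (BoundedFormula.realize_alls.1 (h G hG) ys)
  rwa [Subsingleton.elim (_ ∘ default) default] at this

/-! ### Representing the diagonal-free reduct and the small subalgebras. -/

namespace SplitAlg

variable {V : Type u} {Z P : Type}

theorem exists_blk_eq_snd [AddCommGroup V] (y : Base V Z) (b : ℕ) (_ : blk y = some b) (w : V) :
    ∃ y' : Base V Z, blk y' = some b ∧ Sum.elim (fun x => x.2) (fun _ => 0) y' = w :=
  ⟨.inl (b, w), rfl, rfl⟩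

/-- Without diagonals the map to the base need not be injective. Each point gets `m` copies, and the
copy indices are summed along a transversal to give the label. -/
theorem isRQA [AddCommGroup V] {m : ℕ} [NeZero m] :
    IsRQA (RdQA (SplitAlg V Z (Fin m))) := by
  have : Nonempty (Base V Z) := ⟨.inl (0, 0)⟩
  let f : Base V Z × ZMod m → Base V Z := Prod.fst
  obtain ⟨χ, hχ, hχ'⟩ := exists_coloring (blk ∘ f) Prod.snd
    fun y b hy w => ⟨(y.1, w), hy, rfl⟩
  let c : ZMod m ≃ Fin m := (ZMod.finEquiv m).toEquiv.symm
  let j : RdQA (SplitAlg V Z (Fin m)) → SplitAlg V Z (Fin m) := fun Y => Y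
  refine ⟨Base V Z × ZMod m, Set.univ, isGeneralizedSpace_univ _, ?_⟩
  refine nonempty_embedding j (fun _ _ h => h) (fun _ _ => rfl) f Prod.fst_surjective
    False.elim (fun s => c (χ s)) (fun s τ hs => congrArg c (hχ s τ hs)) fun s i l hs => ?_
  obtain ⟨u, hu, hul⟩ := hχ' s i (c.symm l) hs
  exact ⟨u, hu, fun y t => by rw [hul, Equiv.apply_symm_apply]⟩

theorem isRQEA_closure [AddCommGroup V] [Fintype V] [Nonempty P]
    (G : Finset (SplitAlg V Z P)) (hG : 2 ^ G.card ≤ Fintype.card V) :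
    IsRQEA (Substructure.closure LQEA (G : Set (SplitAlg V Z P))) := by
  classical
  obtain ⟨s₀, hs₀⟩ := exists_isTransversal V Z
  -- All transversals are alike, so the behaviour of a label on the generators can be read off at
  -- `s₀`.
  let ty : P → G → Prop := fun l y => (s₀, l) ∈ y.1.val
  have hcl : ∀ l l', ty l = ty l' → ∀ y ∈ Substructure.closure LQEA (G : Set (SplitAlg V Z P)),
      ∀ s, (s, l) ∈ y.val ↔ (s, l') ∈ y.val := by
    intro l l' hll y hy
    refine Substructure.closure_induction (p := fun y : SplitAlg V Z P =>
      ∀ s, (s, l) ∈ y.val ↔ (s, l') ∈ y.val) hy ?_ ?_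
    · intro y hy s
      by_cases hs : IsTransversal blk s
      · rw [y.2.transversal_iff hs hs₀, y.2.transversal_iff hs hs₀]
        exact iff_of_eq (congrFun hll ⟨y, hy⟩)
      · exact y.2.label_iff hs l l'
    · intro n f x hx
      exact pairOp_label_iff _ hx
  have hcard : Fintype.card (Set.range ty) ≤ Fintype.card V := by
    refine (Fintype.card_le_of_injective _ Subtype.val_injective).trans ?_
    simpa using hG
  obtain ⟨e⟩ := Function.Embedding.nonempty_of_card_le hcard
  have : Nonempty (Set.range ty) := (Set.range_nonempty ty).to_subtype
  -- One label is chosen for each type; there are at most `2 ^ G.card ≤ |V|` types, so `V` maps onto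
  -- them.
  let c : V → P := fun v => (Function.invFun e v).2.choose
  have hc : ∀ l, ∃ v, ty (c v) = ty l := by
    intro l
    refine ⟨e ⟨ty l, l, rfl⟩, ?_⟩
    refine (Function.invFun e _).2.choose_spec.trans ?_
    rw [Function.leftInverse_invFun e.injective]
  obtain ⟨χ, hχ, hχ'⟩ := exists_coloring (blk (V := V) (Z := Z)) _ exists_blk_eq_snd
  have : Nonempty (Base V Z) := ⟨.inl (0, 0)⟩
  refine ⟨Base V Z, Set.univ, isGeneralizedSpace_univ _, ?_⟩
  let j : Substructure.closure LQEA (G : Set (SplitAlg V Z P)) → SplitAlg V Z P := fun Y => Y.1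
  refine nonempty_embedding j (fun _ _ h => Subtype.ext h) ?_ id
    Function.surjective_id (fun _ => Function.injective_id) (fun s => c (χ s))
    (fun s τ hs => congrArg c (hχ s τ hs)) fun s i l hs => ?_
  · intro n f x
    cases f <;> rfl
  · obtain ⟨v, hv⟩ := hc l
    obtain ⟨u, hu, hul⟩ := hχ' s i v hs
    exact ⟨u, hu, fun y t => by rw [hul]; exact hcl _ _ hv y.1 y.2 t⟩

end SplitAlg

/-! ### Choice of the parameters and conclusion. -/

theorem exists_splitting (k : ℕ) : ∃ (B : Type u) (_ : LQEA.Structure B),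
    IsUnionOfSplittings B ∧
    ¬ IsRCA (RdCA B) ∧
    (∀ G : Finset B, G.card ≤ k → IsRQEA (Substructure.closure LQEA (G : Set B))) ∧
    IsRQA (RdQA B) := by
  have hpow : 0 < 2 ^ k := by positivity
  -- The size `2 ^ k` of `V` accommodates all types over `k` generators, `3 * 2 ^ k` codes suffice
  -- for three blocks, and one more label than codes triggers the pigeonhole.
  refine ⟨SplitAlg (ULift.{u} (ZMod (2 ^ k))) (Fin 3 × ZMod (2 ^ k)) (Fin (3 * 2 ^ k + 1)),
    inferInstance, SplitAlg.isUnionOfSplittings (by omega), ?_, fun G hG => ?_, SplitAlg.isRQA⟩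
  · refine SplitAlg.not_isRCA (Prod.map id ULift.down)
      (Function.injective_id.prodMap ULift.down_injective) ?_
    simp [ZMod.card]
  · refine SplitAlg.isRQEA_closure G ?_
    rw [Fintype.card_ulift, ZMod.card]
    exact Nat.pow_le_pow_right (by decide) hG

theorem mainTheorem2 :
    (¬ ∃ (k : ℕ) (T : LQEA.Theory), (∀ φ ∈ T, IsUniversalIn k φ) ∧
      ∀ (A : Type u) [LQEA.Structure A], IsRQEA A ↔ (A ⊨ T ∧ IsRQA (RdQA A))) ∧
    (∀ k : ℕ, ∃ (B : Type u) (_ : LQEA.Structure B),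
      IsUnionOfSplittings B ∧
      ¬ IsRCA (RdCA B) ∧
      (∀ G : Finset B, G.card ≤ k → IsRQEA (Substructure.closure LQEA (G : Set B))) ∧
      IsRQA (RdQA B)) := by
  refine ⟨?_, exists_splitting⟩
  rintro ⟨k, T, hT, hax⟩
  obtain ⟨B, _, -, hRCA, hsub, hRQA⟩ := exists_splitting.{u} k
  refine hRCA (IsRQEA.isRCA ((hax B).2 ⟨⟨fun φ hφ => ?_⟩, hRQA⟩))
  exact (hT φ hφ).realize fun G hG => ((hax _).1 (hsub G hG)).1.realize_of_mem φ hφ
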